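/- Let $n\ge 2$ and let $M$ be a compact connected (Hausdorff) smooth $n$-dimensional manifold with boundary $\partial M$, with a smooth Riemannian metric $g$. Let $\gamma=g|_{\partial M}$, let $\nu$ be the outward unit normal of $\partial M$, and let $II_\gamma(X,Y)=g(\nabla_X\nu,Y)$ be the second fundamental form of $\partial M$. For $f\in C^\infty(M)$ set $\mathcal S_g^*(f)=(A_g^*f,\,B_\gamma^*f)$, where $$A_g^*f=-(\Delta_g f)\,g+\mathrm{Hess}_g f-f\,\mathrm{Ric}_g\ \text{ on } M,\qquad B_\gamma^*f=\frac{\partial f}{\partial\nu}\,\gamma-f\,II_\gamma\ \text{ on }\partial M,$$ with $\Delta_g f=\mathrm{tr}_g(\mathrm{Hess}_g f)$. (This is the explicit form of the $L^2$-formal adjoint, applied to pairs $(f,f)$, of the linearization at $g$ of the map $g\mapsto(R_g,2H_\gamma)$, scalar curvature of $M$ and twice the mean curvature of $\partial M$.) If $(M,\partial M,g)$ is Ricci-flat with totally geodesic boundary, that is, $\mathrm{Ric}_g\equiv 0$ on $M$ and $II_\gamma\equiv0$ on $\partial M$, then $$\ker(\mathcal S_g^*)=\{f\in C^\infty(M):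 \mathcal S_g^*(f)=0\}$$ is exactly the set of constant functions on $M$. Conversely, if $\ker(\mathcal S_g^*)$ is exactly the set of constant functions, then $(M,\partial M,g)$ is Ricci-flat with totally geodesic boundary. -/

import Mathlib

open scoped Manifold ContDiff

/-!
Riemannian geometry in local coordinates on an `n`-dimensional smooth manifold `M` with boundary,
modelled on the half-space `{y ∈ ℝⁿ | 0 ≤ y 0}`. All components below are taken in a chart `e` of
the maximal smooth atlas and are functions on `M`, meaningful on the domain `e.source`.
-/

noncomputable section

namespace RiemBdry

/-- A smooth Riemannian metric on the manifold with boundary `M`. -/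
abbrev Metric (n : ℕ) [NeZero n] (M : Type*) [TopologicalSpace M]
    [ChartedSpace (EuclideanHalfSpace n) M] [IsManifold (𝓡∂ n) ∞ M] :=
  Bundle.ContMDiffRiemannianMetric (𝓡∂ n) ∞ (EuclideanSpace ℝ (Fin n))
    (fun x : M => TangentSpace (𝓡∂ n) x)

/-- The coordinate charts: all charts of the maximal smooth atlas of `M`. -/
abbrev Chart (n : ℕ) [NeZero n] (M : Type*) [TopologicalSpace M]
    [ChartedSpace (EuclideanHalfSpace n) M] :=
  {e : OpenPartialHomeomorph M (EuclideanHalfSpace n) //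
    e ∈ IsManifold.maximalAtlas (𝓡∂ n) ∞ M}

variable {n : ℕ} [NeZero n] {M : Type*} [TopologicalSpace M]
  [ChartedSpace (EuclideanHalfSpace n) M]

/-- The coordinate partial derivative `∂ᵢ u`; it is one-sided in the direction `∂₀` at
boundary points. -/
def pd (e : OpenPartialHomeomorph M (EuclideanHalfSpace n)) (i : Fin n) (u : M → ℝ) (x : M) : ℝ :=
  fderivWithin ℝ (u ∘ (e.extend (𝓡∂ n)).symm) (Set.range (𝓡∂ n)) (e.extend (𝓡∂ n) x)
    (EuclideanSpace.single i 1)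

/-- The coordinate vector `∂ᵢ` at `x`: the tangent vector that the differential of the chart maps
to the `i`-th standard basis vector. -/
def frame (e : OpenPartialHomeomorph M (EuclideanHalfSpace n)) (i : Fin n) (x : M) :
    TangentSpace (𝓡∂ n) x :=
  (mfderiv (𝓡∂ n) 𝓘(ℝ, EuclideanSpace ℝ (Fin n)) (e.extend (𝓡∂ n)) x).inverse
    (EuclideanSpace.single i (1 : ℝ) : EuclideanSpace ℝ (Fin n))

variable [IsManifold (𝓡∂ n) ∞ M]

/-- The matrix `gᵢⱼ = g(∂ᵢ, ∂ⱼ)`. -/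
def gram (g : Metric n M) (e : OpenPartialHomeomorph M (EuclideanHalfSpace n)) (x : M) :
    Matrix (Fin n) (Fin n) ℝ :=
  Matrix.of fun i j => g.inner x (frame e i x) (frame e j x)

/-- The inverse matrix `gⁱʲ`. -/
def gramInv (g : Metric n M) (e : OpenPartialHomeomorph M (EuclideanHalfSpace n)) (x : M) :
    Matrix (Fin n) (Fin n) ℝ :=
  (gram g e x)⁻¹

/-- The Christoffel symbols of the Levi-Civita connection,
`Γᵏᵢⱼ = ½ gᵏˡ (∂ᵢ gⱼₗ + ∂ⱼ gᵢₗ - ∂ₗ gᵢⱼ)`. -/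
def christoffel (g : Metric n M) (e : OpenPartialHomeomorph M (EuclideanHalfSpace n))
    (k i j : Fin n) (x : M) : ℝ :=
  (1 / 2 : ℝ) * ∑ l, gramInv g e x k l *
    (pd e i (fun z => gram g e z j l) x + pd e j (fun z => gram g e z i l) x
      - pd e l (fun z => gram g e z i j) x)

/-- The Ricci tensor,
`Ricᵢⱼ = ∂ₖ Γᵏᵢⱼ - ∂ⱼ Γᵏᵢₖ + Γᵏₖₗ Γˡᵢⱼ - Γᵏⱼₗ Γˡᵢₖ`. -/
def ricci (g : Metric n M) (e : OpenPartialHomeomorph M (EuclideanHalfSpace n))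
    (i j : Fin n) (x : M) : ℝ :=
  ∑ k, (pd e k (christoffel g e k i j) x - pd e j (christoffel g e k i k) x)
    + ∑ k, ∑ l, (christoffel g e k k l x * christoffel g e l i j x
      - christoffel g e k j l x * christoffel g e l i k x)

/-- The Hessian, `(Hess f)ᵢⱼ = ∂ᵢ ∂ⱼ f - Γᵏᵢⱼ ∂ₖ f`. -/
def hess (g : Metric n M) (e : OpenPartialHomeomorph M (EuclideanHalfSpace n))
    (f : M → ℝ) (i j : Fin n) (x : M) : ℝ :=
  pd e i (pd e j f) x - ∑ k, christoffel g e k i j x * pd e k f x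

/-- The Laplacian, the trace of the Hessian, `Δ f = gⁱʲ (Hess f)ᵢⱼ`. -/
def laplacian (g : Metric n M) (e : OpenPartialHomeomorph M (EuclideanHalfSpace n))
    (f : M → ℝ) (x : M) : ℝ :=
  ∑ i, ∑ j, gramInv g e x i j * hess g e f i j x

/-- The components `νᵏ = - gᵏ⁰ / √g⁰⁰` of the outward unit normal at a boundary point. There, the
manifold is `{y 0 ≥ 0}` in the chart and `∂ᵢ`, `i ≠ 0`, span the tangent space of the boundary;
as `g(ν, ∂ᵢ) = - δ⁰ᵢ / √g⁰⁰`, this `ν` is orthogonal to the boundary, has length one, and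
`ν⁰ = - √g⁰⁰ < 0`. -/
def normal (g : Metric n M) (e : OpenPartialHomeomorph M (EuclideanHalfSpace n))
    (k : Fin n) (x : M) : ℝ :=
  -(gramInv g e x k 0) / Real.sqrt (gramInv g e x 0 0)

/-- The outward normal derivative `∂f/∂ν` at a boundary point. -/
def normalDeriv (g : Metric n M) (e : OpenPartialHomeomorph M (EuclideanHalfSpace n))
    (f : M → ℝ) (x : M) : ℝ :=
  ∑ k, normal g e k x * pd e k f x

/-- The second fundamental form of the boundary with respect to the outward unit normal,
`IIᵢⱼ = g(∇_{∂ᵢ} ν, ∂ⱼ) = - g(∇_{∂ᵢ} ∂ⱼ, ν) = - Γᵏᵢⱼ gₖₗ νˡ`, used for indices `i, j ≠ 0`. -/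
def secondFF (g : Metric n M) (e : OpenPartialHomeomorph M (EuclideanHalfSpace n))
    (i j : Fin n) (x : M) : ℝ :=
  -∑ k, ∑ l, christoffel g e k i j x * gram g e x k l * normal g e l x

/-- `Ric = 0` on `M`. -/
def IsRicciFlat (g : Metric n M) : Prop :=
  ∀ e : Chart n M, ∀ x ∈ e.1.source, ∀ i j, ricci g e.1 i j x = 0

/-- The boundary is totally geodesic: `II = 0` on `∂M`. -/
def HasTotallyGeodesicBoundary (g : Metric n M) : Prop :=
  ∀ e : Chart n M, ∀ x ∈ e.1.source ∩ (𝓡∂ n).boundary M, ∀ i j, i ≠ 0 → j ≠ 0 →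
    secondFF g e.1 i j x = 0

variable (n M) in
/-- Covariant 2-tensor fields on `M`, given by their components in every chart. -/
abbrev Tensor2 :=
  ∀ e : Chart n M, e.1.source → Fin n → Fin n → ℝ

variable (n M) in
/-- Covariant 2-tensor fields on `∂M`, given by their components, in every chart of `M`, with
respect to the coordinate vectors `∂ᵢ`, `i ≠ 0`, tangent to the boundary. -/
abbrev BdryTensor2 :=
  ∀ e : Chart n M, ↥(e.1.source ∩ (𝓡∂ n).boundary M) →
    {i : Fin n // i ≠ 0} → {i : Fin n // i ≠ 0} → ℝ

/-- `A_g^* f = -(Δ f) g + Hess f - f Ric`. -/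
def adjointInt (g : Metric n M) (f : M → ℝ) : Tensor2 n M := fun e x i j =>
  -(laplacian g e.1 f x) * gram g e.1 x i j + hess g e.1 f i j x - f x * ricci g e.1 i j x

/-- `B_γ^* f = (∂f/∂ν) γ - f II`, where `γ` is the metric induced on the boundary. -/
def adjointBdry (g : Metric n M) (f : M → ℝ) : BdryTensor2 n M := fun e x i j =>
  normalDeriv g e.1 f x * gram g e.1 x i j - f x * secondFF g e.1 i j x

/-- The operator `S_g^* f = (A_g^* f, B_γ^* f)` on smooth functions. -/
def adjointOp (g : Metric n M) (f : C^∞⟮𝓡∂ n, M; 𝓘(ℝ, ℝ), ℝ⟯) : Tensor2 n M × BdryTensor2 n M :=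
  (adjointInt g f, adjointBdry g f)

/-- The kernel of `S_g^*`. -/
def kerAdjoint (g : Metric n M) : Set C^∞⟮𝓡∂ n, M; 𝓘(ℝ, ℝ), ℝ⟯ :=
  {f | adjointOp g f = 0}

end RiemBdry

end

/-!
Let `f` be in the kernel, with `Ric = 0` and `II = 0`. Then `Hess f = (Δ f) g`, whose trace is
`Δ f = n Δ f`, so `Hess f = 0` because `n ≠ 1`; and `∂f/∂ν = 0` on the boundary, which has positive
dimension. The equation `Hess f = 0` is a linear first-order system for `df`, so by Gronwall's
inequality the critical points of `f` form an open and closed set. A maximum point of `f` is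
critical, at the boundary thanks to `∂f/∂ν = 0`; hence `df` vanishes identically and `f` is
constant. Conversely, the constant `1` is mapped to `(-Ric, -II)`.
-/

open Set Topology

namespace RiemBdry

section Gronwall

variable {E F : Type*} [NormedAddCommGroup E] [NormedSpace ℝ E] [NormedAddCommGroup F]
  [NormedSpace ℝ F]

theorem eqOn_zero_of_norm_fderivWithin_le {s : Set E} (hs : Convex ℝ s) {V : E → F}
    {V' : E → E →L[ℝ] F} {c : E → ℝ} (hV : ∀ y ∈ s, HasFDerivWithinAt V (V' y) s y)
    (hc : ContinuousOn c s) (hV' : ∀ y ∈ s, ‖V' y‖ ≤ c y * ‖V y‖) {z : E} (hz : z ∈ s)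
    (hVz : V z = 0) : EqOn V 0 s := by
  intro w hw
  let γ : ℝ → E := AffineMap.lineMap z w
  have hγ : MapsTo γ (Icc 0 1) s := fun t ht => hs.lineMap_mem hz hw ht
  have hγc : Continuous γ := AffineMap.lineMap_continuous
  obtain ⟨C, hC⟩ := isCompact_Icc.exists_bound_of_continuousOn (hc.comp hγc.continuousOn hγ)
  have hd : ∀ t ∈ Icc (0 : ℝ) 1,
      HasDerivWithinAt (V ∘ γ) (V' (γ t) (w - z)) (Icc 0 1) t := fun t ht =>
    (hV _ (hγ ht)).comp_hasDerivWithinAt t AffineMap.hasDerivWithinAt_lineMap hγ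
  have hbound : ∀ t ∈ Ico (0 : ℝ) 1, ‖V' (γ t) (w - z)‖ ≤ C * ‖w - z‖ * ‖(V ∘ γ) t‖ := by
    intro t ht
    replace ht := Ico_subset_Icc_self ht
    calc ‖V' (γ t) (w - z)‖ ≤ ‖V' (γ t)‖ * ‖w - z‖ := (V' (γ t)).le_opNorm _
      _ ≤ C * ‖V (γ t)‖ * ‖w - z‖ := by
        gcongr
        refine (hV' _ (hγ ht)).trans ?_
        gcongr
        exact (le_abs_self _).trans (hC t ht)
      _ = C * ‖w - z‖ * ‖(V ∘ γ) t‖ := by rw [Function.comp_apply]; ring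
  have h : (V ∘ γ) 1 = 0 := eq_zero_of_abs_deriv_le_mul_abs_self_of_eq_zero_right
    (fun t ht => (hd t ht).continuousWithinAt)
    (fun t ht => (hd t (Ico_subset_Icc_self ht)).mono_of_mem_nhdsWithin (Icc_mem_nhdsGE_of_mem ht))
    (by simpa [γ] using hVz) hbound 1 (by simp)
  simpa [γ] using h

end Gronwall

theorem norm_le_sum_norm_apply {ι 𝕜 E F : Type*} [Fintype ι] [RCLike 𝕜] [NormedAddCommGroup E]
    [InnerProductSpace 𝕜 E] [SeminormedAddCommGroup F] [NormedSpace 𝕜 F]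
    (b : OrthonormalBasis ι 𝕜 E) (L : E →L[𝕜] F) : ‖L‖ ≤ ∑ i, ‖L (b i)‖ := by
  refine L.opNorm_le_bound (by positivity) fun x => ?_
  calc ‖L x‖ = ‖∑ i, b.repr x i • L (b i)‖ := by
        conv_lhs => rw [← b.sum_repr x, map_sum]
        simp only [map_smul]
    _ ≤ ∑ i, ‖b.repr x i‖ * ‖L (b i)‖ := by
        simpa only [norm_smul] using norm_sum_le Finset.univ fun i => b.repr x i • L (b i)
    _ ≤ ∑ i, ‖x‖ * ‖L (b i)‖ := by
        gcongr with i
        exact (PiLp.norm_apply_le _ i).trans_eq (b.repr.norm_map x)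
    _ = (∑ i, ‖L (b i)‖) * ‖x‖ := by rw [← Finset.mul_sum, mul_comm]

section Charts

variable {E H M F : Type*} [NormedAddCommGroup E] [NormedSpace ℝ E] [TopologicalSpace H]
  {I : ModelWithCorners ℝ E H} [TopologicalSpace M]

theorem exists_mem_nhds_convex_image_extend (e : OpenPartialHomeomorph M H) {p : M}
    (hp : p ∈ e.source) : ∃ U ∈ 𝓝 p, U ⊆ e.source ∧ Convex ℝ (e.extend I '' U) := by
  obtain ⟨r, hr, hball⟩ := Metric.mem_nhdsWithin_iff.1 (e.extend_target_mem_nhdsWithin (I := I) hp)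
  have hS : Metric.ball (e.extend I p) r ∩ range I ∈ 𝓝[range I] e.extend I p :=
    Filter.inter_mem (mem_nhdsWithin_of_mem_nhds (Metric.ball_mem_nhds _ hr)) self_mem_nhdsWithin
  refine ⟨e.source ∩ e.extend I ⁻¹' (Metric.ball (e.extend I p) r ∩ range I),
    Filter.inter_mem (e.open_source.mem_nhds hp)
      (e.extend_preimage_mem_nhds_of_mem_nhdsWithin hp hS), inter_subset_left, ?_⟩
  rw [image_inter_preimage, ← e.extend_source (I := I), (e.extend I).image_source_eq_target,
    inter_eq_right.2 hball]
  exact (convex_ball _ _).inter I.convex_range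

variable [ChartedSpace H M] {e : OpenPartialHomeomorph M H}

theorem mdifferentiable_of_mem_maximalAtlas (he : e ∈ IsManifold.maximalAtlas I 1 M) :
    e.MDifferentiable I I :=
  ⟨(contMDiffOn_of_mem_maximalAtlas he).mdifferentiableOn one_ne_zero,
    (contMDiffOn_symm_of_mem_maximalAtlas he).mdifferentiableOn one_ne_zero⟩

variable {x : M}

theorem hasMFDerivAt_extend (he : e ∈ IsManifold.maximalAtlas I 1 M) (hx : x ∈ e.source) :
    HasMFDerivAt I 𝓘(ℝ, E) (e.extend I) x (mfderiv I I e x) :=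
  I.hasMFDerivAt.comp x
    ((mdifferentiable_of_mem_maximalAtlas he).mdifferentiableAt hx).hasMFDerivAt

variable [NormedAddCommGroup F] [NormedSpace ℝ F] {f : M → F}

theorem differentiableWithinAt_comp_extend_symm (he : e ∈ IsManifold.maximalAtlas I 1 M)
    (hx : x ∈ e.source) (hf : MDifferentiableAt I 𝓘(ℝ, F) f x) :
    DifferentiableWithinAt ℝ (f ∘ (e.extend I).symm) (range I) (e.extend I x) := by
  rw [← mdifferentiableWithinAt_iff_differentiableWithinAt]
  have hI : I.symm (e.extend I x) = e x := I.left_inv _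
  have he' : MDifferentiableAt I I e.symm (I.symm (e.extend I x)) := by
    rw [hI]
    exact (mdifferentiable_of_mem_maximalAtlas he).mdifferentiableAt_symm (e.map_source hx)
  have hf' : MDifferentiableAt I 𝓘(ℝ, F) f (e.symm (I.symm (e.extend I x))) := by
    rwa [hI, e.left_inv hx]
  exact (hf'.comp _ he').comp_mdifferentiableWithinAt _
    (I.mdifferentiableWithinAt_symm (mem_range_self _))

theorem isInvertible_mfderiv_extend (he : e ∈ IsManifold.maximalAtlas I 1 M) (hx : x ∈ e.source) :
    (mfderiv I 𝓘(ℝ, E) (e.extend I) x).IsInvertible := by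
  rw [(hasMFDerivAt_extend he hx).mfderiv]
  exact ⟨(mdifferentiable_of_mem_maximalAtlas he).mfderiv hx, rfl⟩

theorem mfderiv_apply_eq_fderivWithin (he : e ∈ IsManifold.maximalAtlas I 1 M)
    (hx : x ∈ e.source) (hf : MDifferentiableAt I 𝓘(ℝ, F) f x) (v : TangentSpace I x) :
    mfderiv I 𝓘(ℝ, F) f x v = fderivWithin ℝ (f ∘ (e.extend I).symm) (range I) (e.extend I x)
      (mfderiv I 𝓘(ℝ, E) (e.extend I) x v) := by
  have h := (differentiableWithinAt_comp_extend_symm he hx hf).hasFDerivWithinAt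
    |>.hasMFDerivWithinAt.comp (s := univ) x
      (hasMFDerivAt_extend he hx).mdifferentiableAt.hasMFDerivAt.hasMFDerivWithinAt
      (fun y _ => mem_range_self _)
  rw [hasMFDerivWithinAt_univ] at h
  have hfe : f =ᶠ[𝓝 x] (f ∘ (e.extend I).symm) ∘ e.extend I := by
    filter_upwards [e.open_source.mem_nhds hx] with z hz
    exact (congrArg f (e.extend_left_inv hz)).symm
  exact congrArg (· v) (h.congr_of_eventuallyEq hfe).mfderiv

theorem hasFDerivWithinAt_zero_comp_extend_symm (he : e ∈ IsManifold.maximalAtlas I 1 M)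
    (hx : x ∈ e.source) (hf : MDifferentiableAt I 𝓘(ℝ, F) f x)
    (hf' : mfderiv I 𝓘(ℝ, F) f x = 0) :
    HasFDerivWithinAt (f ∘ (e.extend I).symm) (0 : E →L[ℝ] F) (range I) (e.extend I x) := by
  convert (differentiableWithinAt_comp_extend_symm he hx hf).hasFDerivWithinAt
  ext w
  obtain ⟨v, rfl⟩ := (isInvertible_mfderiv_extend he hx).bijective.surjective w
  exact ((congrArg (· v) hf').symm.trans (mfderiv_apply_eq_fderivWithin he hx hf v))

theorem isLocallyConstant_of_mfderiv_eq_zero [IsManifold I 1 M] (hf : MDifferentiable I 𝓘(ℝ, F) f)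
    (hf' : ∀ x, mfderiv I 𝓘(ℝ, F) f x = 0) : IsLocallyConstant f := by
  refine (IsLocallyConstant.iff_eventually_eq f).2 fun p => ?_
  let e := chartAt H p
  have he : e ∈ IsManifold.maximalAtlas I 1 M := IsManifold.chart_mem_maximalAtlas p
  obtain ⟨U, hU, hUe, hconv⟩ :=
    exists_mem_nhds_convex_image_extend (I := I) e (mem_chart_source H p)
  have hd : ∀ y ∈ e.extend I '' U, HasFDerivWithinAt (f ∘ (e.extend I).symm)
      (0 : E →L[ℝ] F) (e.extend I '' U) y := by
    rintro _ ⟨z, hz, rfl⟩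
    exact (hasFDerivWithinAt_zero_comp_extend_symm he (hUe hz) (hf z) (hf' z)).mono
      (image_subset_iff.2 fun _ _ => mem_range_self _)
  filter_upwards [hU] with z hz
  have h := hconv.norm_image_sub_le_of_norm_hasFDerivWithin_le hd (fun _ _ => norm_zero.le)
    (mem_image_of_mem _ (mem_of_mem_nhds hU)) (mem_image_of_mem _ hz)
  rw [zero_mul, norm_le_zero_iff, sub_eq_zero] at h
  simpa only [Function.comp_apply, e.extend_left_inv (hUe hz),
    e.extend_left_inv (mem_chart_source H p)] using h

end Charts

section Coordinates

variable {n : ℕ} [NeZero n] {M : Type*} [TopologicalSpace M]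

theorem pd_const (e : OpenPartialHomeomorph M (EuclideanHalfSpace n)) (i : Fin n) (c : ℝ) (x : M) :
    pd e i (fun _ => c) x = 0 := by
  simp [pd, Function.comp_def]

variable [ChartedSpace (EuclideanHalfSpace n) M] (e : Chart n M) {x : M} {f : M → ℝ}

theorem Chart.mem_maximalAtlas_one : e.1 ∈ IsManifold.maximalAtlas (𝓡∂ n) 1 M :=
  IsManifold.maximalAtlas_subset_of_le (by simp) e.2

theorem contDiffOn_comp_extend_symm (hf : ContMDiffOn (𝓡∂ n) 𝓘(ℝ, ℝ) ∞ f e.1.source) :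
    ContDiffOn ℝ ∞ (f ∘ (e.1.extend (𝓡∂ n)).symm) (e.1.extend (𝓡∂ n)).target := by
  rw [← contMDiffOn_iff_contDiffOn]
  refine hf.comp ?_ ?_
  · rw [e.1.extend_target']
    exact contMDiffOn_extend_symm e.2
  · intro y hy
    rw [mem_preimage, ← e.1.extend_source (I := 𝓡∂ n)]
    exact (e.1.extend (𝓡∂ n)).map_target hy

theorem mfderiv_extend_frame (hx : x ∈ e.1.source) (i : Fin n) :
    mfderiv (𝓡∂ n) 𝓘(ℝ, EuclideanSpace ℝ (Fin n)) (e.1.extend (𝓡∂ n)) x (frame e.1 i x) =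
      EuclideanSpace.single i (1 : ℝ) :=
  (isInvertible_mfderiv_extend e.mem_maximalAtlas_one hx).self_apply_inverse _

theorem pd_eq_mfderiv_frame (hf : MDifferentiableAt (𝓡∂ n) 𝓘(ℝ, ℝ) f x)
    (hx : x ∈ e.1.source) (i : Fin n) :
    pd e.1 i f x = mfderiv (𝓡∂ n) 𝓘(ℝ, ℝ) f x (frame e.1 i x) := by
  refine .trans ?_ (mfderiv_apply_eq_fderivWithin e.mem_maximalAtlas_one hx hf _).symm
  rw [mfderiv_extend_frame e hx]
  rfl

/-- The coordinate vectors at a point of the domain of a chart, as a basis of the tangent space;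
its Gram matrix is `gram`, and `df` vanishes as soon as it vanishes on this basis. -/
noncomputable def frameBasis (hx : x ∈ e.1.source) :
    Module.Basis (Fin n) ℝ (TangentSpace (𝓡∂ n) x) :=
  (EuclideanSpace.basisFun (Fin n) ℝ).toBasis.map
    ((mdifferentiable_of_mem_maximalAtlas e.mem_maximalAtlas_one).mfderiv hx).symm.toLinearEquiv

theorem frameBasis_apply (hx : x ∈ e.1.source) (i : Fin n) :
    frameBasis e hx i = frame e.1 i x := by
  let φ := (mdifferentiable_of_mem_maximalAtlas e.mem_maximalAtlas_one).mfderiv hx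
  have hφ : frameBasis e hx i = φ.symm (EuclideanSpace.single i (1 : ℝ)) :=
    congrArg φ.symm (EuclideanSpace.basisFun_apply (Fin n) ℝ i)
  apply (isInvertible_mfderiv_extend e.mem_maximalAtlas_one hx).bijective.injective
  rw [mfderiv_extend_frame e hx, (hasMFDerivAt_extend e.mem_maximalAtlas_one hx).mfderiv, hφ]
  exact φ.apply_symm_apply _

theorem mfderiv_eq_zero_iff (hf : MDifferentiableAt (𝓡∂ n) 𝓘(ℝ, ℝ) f x) (hx : x ∈ e.1.source) :
    mfderiv (𝓡∂ n) 𝓘(ℝ, ℝ) f x = 0 ↔ ∀ i, pd e.1 i f x = 0 := by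
  simp only [pd_eq_mfderiv_frame e hf hx, ← frameBasis_apply e hx]
  refine ⟨fun h i => by rw [h]; rfl, fun h => ?_⟩
  exact ContinuousLinearMap.coe_injective ((frameBasis e hx).ext h)

theorem contMDiffOn_pd (hf : ContMDiffOn (𝓡∂ n) 𝓘(ℝ, ℝ) ∞ f e.1.source) (i : Fin n) :
    ContMDiffOn (𝓡∂ n) 𝓘(ℝ, ℝ) ∞ (pd e.1 i f) e.1.source := by
  have hu : UniqueDiffOn ℝ (e.1.extend (𝓡∂ n)).target := by
    rw [e.1.extend_target]
    exact (𝓡∂ n).uniqueDiffOn_preimage e.1.open_target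
  have hF := contDiffOn_comp_extend_symm e hf
  have hd := (hF.fderivWithin (m := ∞) hu (by simp)).clm_apply
    (contDiffOn_const (c := EuclideanSpace.single i (1 : ℝ)))
  refine ((contMDiffOn_iff_contDiffOn.2 hd).comp (e.1.contMDiffOn_extend e.2)
    fun x hx => ?_).congr fun x hx => ?_
  · exact (e.1.extend (𝓡∂ n)).map_source (by rwa [e.1.extend_source])
  · rw [pd, Function.comp_apply]
    have hy : e.1.extend (𝓡∂ n) x ∈ (e.1.extend (𝓡∂ n)).target :=
      (e.1.extend (𝓡∂ n)).map_source (by rwa [e.1.extend_source])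
    rw [fderivWithin_of_mem_nhdsWithin (e.1.extend_target_mem_nhdsWithin hx)
      ((𝓡∂ n).uniqueDiffOn _ (mem_range_self _)) (hF.differentiableOn (by simp) _ hy)]

variable [IsManifold (𝓡∂ n) ∞ M]

theorem contMDiffOn_frame (i : Fin n) :
    ContMDiffOn (𝓡∂ n) (𝓡∂ n).tangent ∞ (T% (frame e.1 i)) e.1.source := by
  intro x hx
  let V (y : EuclideanSpace ℝ (Fin n)) : TangentSpace 𝓘(ℝ, EuclideanSpace ℝ (Fin n)) y :=
    EuclideanSpace.single i (1 : ℝ)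
  have hV : CMDiffAt ∞ (T% V) (e.1.extend (𝓡∂ n) x) :=
    (contMDiffAt_vectorSpace_iff_contDiffAt (V := V)).2 contDiffAt_const
  exact (ContMDiffAt.mpullback_vectorField_preimage (n := ∞) hV
    ((e.1.contMDiffOn_extend e.2).contMDiffAt (e.1.open_source.mem_nhds hx))
    (isInvertible_mfderiv_extend e.mem_maximalAtlas_one hx) (by simp)).contMDiffWithinAt

variable (g : Metric n M)

theorem contMDiffOn_gram (i j : Fin n) :
    ContMDiffOn (𝓡∂ n) 𝓘(ℝ, ℝ) ∞ (fun x => gram g e.1 x i j) e.1.source := by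
  intro x hx
  have h := ContMDiffOn.clm_bundle_apply₂ (F₁ := EuclideanSpace ℝ (Fin n))
    (F₂ := EuclideanSpace ℝ (Fin n)) (F₃ := ℝ) (E₃ := Bundle.Trivial M ℝ)
    g.contMDiff.contMDiffOn (contMDiffOn_frame e i) (contMDiffOn_frame e j) x hx
  rw [Bundle.contMDiffWithinAt_totalSpace] at h
  exact h.2

theorem posDef_gram (hx : x ∈ e.1.source) : (gram g e.1 x).PosDef := by
  have hsymm : (g.inner x).toBilinForm.IsSymm := ⟨fun v w => g.symm x v w⟩
  have hpos : (g.inner x).toBilinForm.toQuadraticMap.PosDef := fun v hv => g.pos x v hv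
  have hgram : (g.inner x).toBilinForm.toMatrix (frameBasis e hx) = gram g e.1 x := by
    ext i j
    simp [LinearMap.BilinForm.toMatrix_apply, frameBasis_apply, gram]
  rw [← hgram]
  exact (LinearMap.BilinForm.posDef_toQuadraticMap_iff_matrix (frameBasis e hx) _ hsymm).1 hpos

theorem continuousOn_gramInv (i j : Fin n) :
    ContinuousOn (fun x => gramInv g e.1 x i j) e.1.source := by
  have hgram : ContinuousOn (gram g e.1) e.1.source :=
    continuousOn_pi.2 fun i => continuousOn_pi.2 fun j => (contMDiffOn_gram e g i j).continuousOn
  simp only [gramInv, Matrix.inv_def, Ring.inverse_eq_inv', Matrix.smul_apply, smul_eq_mul]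
  have hdet : ContinuousOn (fun x => (gram g e.1 x).det) e.1.source :=
    continuous_id.matrix_det.comp_continuousOn hgram
  exact (hdet.inv₀ fun x hx => (posDef_gram e g hx).det_pos.ne').mul
    ((continuous_id.matrix_adjugate.matrix_elem i j).comp_continuousOn hgram)

theorem continuousOn_christoffel (k i j : Fin n) :
    ContinuousOn (christoffel g e.1 k i j) e.1.source := by
  have hpd (i j l : Fin n) : ContinuousOn (pd e.1 l fun z => gram g e.1 z i j) e.1.source :=
    (contMDiffOn_pd e (contMDiffOn_gram e g i j) l).continuousOn
  exact continuousOn_const.mul <| continuousOn_finsetSum _ fun l _ =>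
    (continuousOn_gramInv e g k l).mul (((hpd j l i).add (hpd i l j)).sub (hpd i j l))

end Coordinates

section Maximum

variable {n : ℕ} [NeZero n] {M : Type*} [TopologicalSpace M] {f : M → ℝ} {x : M}

theorem pd_eq_zero_of_isLocalMax (e : OpenPartialHomeomorph M (EuclideanHalfSpace n))
    (hx : x ∈ e.source) (hf : IsLocalMax f x) {i : Fin n}
    (hi : i ≠ 0 ∨ 0 < e.extend (𝓡∂ n) x 0) : pd e i f x = 0 := by
  set y := e.extend (𝓡∂ n) x with hy
  have hmax : IsLocalMaxOn (f ∘ (e.extend (𝓡∂ n)).symm) (range (𝓡∂ n)) y := by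
    have h : ∀ᶠ z in 𝓝 y, f ((e.extend (𝓡∂ n)).symm z) ≤ f x :=
      (e.continuousAt_extend_symm (I := 𝓡∂ n) hx).eventually (by rwa [e.extend_left_inv hx])
    filter_upwards [mem_nhdsWithin_of_mem_nhds h] with z hz
    rwa [Function.comp_apply, Function.comp_apply, hy, e.extend_left_inv hx]
  have hmem : ∀ᶠ t : ℝ in 𝓝 0, y + t • EuclideanSpace.single i (1 : ℝ) ∈ range (𝓡∂ n) := by
    have hy0 : y ∈ range (𝓡∂ n) := mem_range_self _
    rw [range_modelWithCornersEuclideanHalfSpace] at hy0 ⊢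
    rcases hi with hi | hi
    · exact .of_forall fun t => by simpa [hi.symm] using hy0
    · have hc : Continuous fun t : ℝ => (y + t • EuclideanSpace.single i (1 : ℝ)) 0 := by fun_prop
      exact ((hc.tendsto 0).eventually (lt_mem_nhds (by simpa using hi))).mono fun t ht => ht.le
  have hmem' : ∀ᶠ t : ℝ in 𝓝 0, y + t • -EuclideanSpace.single i (1 : ℝ) ∈ range (𝓡∂ n) := by
    have hneg : Filter.Tendsto (fun t : ℝ => -t) (𝓝 0) (𝓝 0) := by
      simpa only [neg_zero] using (continuous_neg (G := ℝ)).tendsto 0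
    simpa only [smul_neg, neg_smul] using hneg.eventually hmem
  exact hmax.fderivWithin_eq_zero
    (mem_posTangentConeAt_of_frequently_mem (hmem.filter_mono nhdsWithin_le_nhds).frequently)
    (mem_posTangentConeAt_of_frequently_mem (hmem'.filter_mono nhdsWithin_le_nhds).frequently)

variable [ChartedSpace (EuclideanHalfSpace n) M] [IsManifold (𝓡∂ n) ∞ M] (g : Metric n M)

theorem pd_zero_eq_zero_of_normalDeriv_eq_zero (e : Chart n M) (hx : x ∈ e.1.source)
    (hν : normalDeriv g e.1 f x = 0) (htan : ∀ i ≠ 0, pd e.1 i f x = 0) : pd e.1 0 f x = 0 := by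
  have hpos : 0 < gramInv g e.1 x 0 0 := (posDef_gram e g hx).inv.diag_pos
  have hnormal : normal g e.1 0 x ≠ 0 :=
    div_ne_zero (neg_ne_zero.2 hpos.ne') (Real.sqrt_pos.2 hpos).ne'
  rw [normalDeriv, Fintype.sum_eq_single 0 fun k hk => by rw [htan k hk, mul_zero]] at hν
  exact (mul_eq_zero.1 hν).resolve_left hnormal

theorem mfderiv_eq_zero_of_isLocalMax (hfd : MDifferentiableAt (𝓡∂ n) 𝓘(ℝ, ℝ) f x)
    (hf : IsLocalMax f x) (hν : x ∈ (𝓡∂ n).boundary M →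
      normalDeriv g (chartAt (EuclideanHalfSpace n) x) f x = 0) :
    mfderiv (𝓡∂ n) 𝓘(ℝ, ℝ) f x = 0 := by
  let e : Chart n M := ⟨chartAt _ x, IsManifold.chart_mem_maximalAtlas x⟩
  have hx : x ∈ e.1.source := mem_chart_source _ x
  have htan : ∀ i ≠ 0, pd e.1 i f x = 0 := fun i hi =>
    pd_eq_zero_of_isLocalMax e.1 hx hf (.inl hi)
  have h0 : pd e.1 0 f x = 0 := by
    have hy : 0 ≤ e.1.extend (𝓡∂ n) x 0 := (e.1 x).2
    rcases hy.lt_or_eq with hpos | hzero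
    · exact pd_eq_zero_of_isLocalMax e.1 hx hf (.inr hpos)
    · refine pd_zero_eq_zero_of_normalDeriv_eq_zero g e hx (hν ?_) htan
      change e.1.extend (𝓡∂ n) x ∈ frontier (range (𝓡∂ n))
      rw [frontier_range_modelWithCornersEuclideanHalfSpace]
      exact hzero
  refine (mfderiv_eq_zero_iff e hfd hx).2 fun i => ?_
  rcases eq_or_ne i 0 with rfl | hi
  exacts [h0, htan i hi]

end Maximum

section Hessian

variable {n : ℕ} [NeZero n] {M : Type*} [TopologicalSpace M]

/-- The components `∂ᵢ f` of the differential of `f` in a chart, bundled into a vector: the unknown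
of the first-order system that `Hess f = 0` becomes. -/
noncomputable def partials (e : OpenPartialHomeomorph M (EuclideanHalfSpace n)) (f : M → ℝ)
    (x : M) : Fin n → ℝ :=
  fun i => pd e i f x

variable [ChartedSpace (EuclideanHalfSpace n) M] (e : Chart n M) {f : M → ℝ} {x : M}

theorem differentiableWithinAt_partials_comp_extend_symm
    (hf : ContMDiffOn (𝓡∂ n) 𝓘(ℝ, ℝ) ∞ f e.1.source) (hx : x ∈ e.1.source) :
    DifferentiableWithinAt ℝ (partials e.1 f ∘ (e.1.extend (𝓡∂ n)).symm) (range (𝓡∂ n))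
      (e.1.extend (𝓡∂ n) x) := by
  have h : ContMDiffOn (𝓡∂ n) 𝓘(ℝ, Fin n → ℝ) ∞ (partials e.1 f) e.1.source :=
    contMDiffOn_pi_space.2 (contMDiffOn_pd e hf)
  exact differentiableWithinAt_comp_extend_symm e.mem_maximalAtlas_one hx
    ((h.contMDiffAt (e.1.open_source.mem_nhds hx)).mdifferentiableAt (by simp))

theorem fderivWithin_partials_apply_single (hf : ContMDiffOn (𝓡∂ n) 𝓘(ℝ, ℝ) ∞ f e.1.source)
    (hx : x ∈ e.1.source) (i j : Fin n) :
    fderivWithin ℝ (partials e.1 f ∘ (e.1.extend (𝓡∂ n)).symm) (range (𝓡∂ n))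
      (e.1.extend (𝓡∂ n) x) (EuclideanSpace.single i 1) j = pd e.1 i (pd e.1 j f) x :=
  congrArg (· (EuclideanSpace.single i 1)) (fderivWithin_apply
    (differentiableWithinAt_partials_comp_extend_symm e hf hx)
    ((𝓡∂ n).uniqueDiffOn _ (mem_range_self _)) j).symm

variable [IsManifold (𝓡∂ n) ∞ M] (g : Metric n M)

theorem norm_fderivWithin_partials_le (hf : ContMDiffOn (𝓡∂ n) 𝓘(ℝ, ℝ) ∞ f e.1.source)
    (hx : x ∈ e.1.source) (hess0 : ∀ i j, hess g e.1 f i j x = 0) :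
    ‖fderivWithin ℝ (partials e.1 f ∘ (e.1.extend (𝓡∂ n)).symm) (range (𝓡∂ n))
      (e.1.extend (𝓡∂ n) x)‖ ≤
      (∑ i, ∑ j, ∑ k, |christoffel g e.1 k i j x|) * ‖partials e.1 f x‖ := by
  set L := fderivWithin ℝ (partials e.1 f ∘ (e.1.extend (𝓡∂ n)).symm) (range (𝓡∂ n))
    (e.1.extend (𝓡∂ n) x)
  have hL (i j : Fin n) : L (EuclideanSpace.single i 1) j =
      ∑ k, christoffel g e.1 k i j x * partials e.1 f x k :=
    (fderivWithin_partials_apply_single e hf hx i j).trans (sub_eq_zero.1 (hess0 i j))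
  have hLij (i j : Fin n) : ‖L (EuclideanSpace.single i 1) j‖ ≤
      ∑ k, |christoffel g e.1 k i j x| * ‖partials e.1 f x‖ := by
    rw [hL]
    refine norm_sum_le_of_le _ fun k _ => ?_
    rw [norm_mul, Real.norm_eq_abs]
    gcongr
    exact norm_le_pi_norm _ k
  have hLi (i : Fin n) : ‖L (EuclideanSpace.single i 1)‖ ≤
      ∑ j, ‖L (EuclideanSpace.single i 1) j‖ :=
    (pi_norm_le_iff_of_nonneg (by positivity)).2 fun j =>
      Finset.single_le_sum (fun j _ => norm_nonneg (L (EuclideanSpace.single i 1) j))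
        (Finset.mem_univ j)
  calc ‖L‖ ≤ ∑ i, ‖L (EuclideanSpace.single i 1)‖ := by
        simpa only [EuclideanSpace.basisFun_apply] using
          norm_le_sum_norm_apply (EuclideanSpace.basisFun (Fin n) ℝ) L
    _ ≤ ∑ i, ∑ j, ∑ k, |christoffel g e.1 k i j x| * ‖partials e.1 f x‖ :=
        Finset.sum_le_sum fun i _ => (hLi i).trans (Finset.sum_le_sum fun j _ => hLij i j)
    _ = (∑ i, ∑ j, ∑ k, |christoffel g e.1 k i j x|) * ‖partials e.1 f x‖ := by
        simp only [Finset.sum_mul]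

theorem eqOn_partials_zero {U : Set M} (hU : U ⊆ e.1.source)
    (hconv : Convex ℝ (e.1.extend (𝓡∂ n) '' U)) (hf : ContMDiffOn (𝓡∂ n) 𝓘(ℝ, ℝ) ∞ f e.1.source)
    (hess0 : ∀ x ∈ U, ∀ i j, hess g e.1 f i j x = 0) (hx : x ∈ U) (hfx : partials e.1 f x = 0) :
    EqOn (partials e.1 f) 0 U := by
  let φ := e.1.extend (𝓡∂ n)
  have hφ : ∀ z ∈ U, φ.symm (φ z) = z := fun z hz => e.1.extend_left_inv (hU hz)
  have hd : ∀ y ∈ φ '' U, HasFDerivWithinAt (partials e.1 f ∘ φ.symm)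
      (fderivWithin ℝ (partials e.1 f ∘ φ.symm) (range (𝓡∂ n)) y) (φ '' U) y := by
    rintro _ ⟨z, hz, rfl⟩
    exact (differentiableWithinAt_partials_comp_extend_symm e hf (hU hz)).hasFDerivWithinAt.mono
      (image_subset_iff.2 fun _ _ => mem_range_self _)
  have hc : ContinuousOn (fun y => ∑ i, ∑ j, ∑ k, |christoffel g e.1 k i j (φ.symm y)|)
      (φ '' U) := by
    refine continuousOn_finsetSum _ fun i _ => continuousOn_finsetSum _ fun j _ =>
      continuousOn_finsetSum _ fun k _ => ((continuousOn_christoffel e g k i j).comp ?_ ?_).abs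
    · rintro _ ⟨z, hz, rfl⟩
      exact (e.1.continuousAt_extend_symm (hU hz)).continuousWithinAt
    · rintro _ ⟨z, hz, rfl⟩
      rw [hφ z hz]
      exact hU hz
  have hzero := eqOn_zero_of_norm_fderivWithin_le hconv hd hc
    (by
      rintro _ ⟨z, hz, rfl⟩
      simpa only [Function.comp_apply, φ, e.1.extend_left_inv (hU hz)] using
        norm_fderivWithin_partials_le e g hf (hU hz) (hess0 z hz))
    (mem_image_of_mem φ hx) (by rw [Function.comp_apply, hφ x hx, hfx])
  intro z hz
  rw [← hφ z hz]
  exact hzero (mem_image_of_mem φ hz)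

variable {g}

theorem isLocallyConstant_mfderiv_eq_zero (hf : ContMDiff (𝓡∂ n) 𝓘(ℝ, ℝ) ∞ f)
    (hess0 : ∀ e : Chart n M, ∀ x ∈ e.1.source, ∀ i j, hess g e.1 f i j x = 0) :
    IsLocallyConstant fun x => mfderiv (𝓡∂ n) 𝓘(ℝ, ℝ) f x = 0 := by
  refine (IsLocallyConstant.iff_eventually_eq _).2 fun p => ?_
  let e : Chart n M := ⟨chartAt _ p, IsManifold.chart_mem_maximalAtlas p⟩
  obtain ⟨U, hU, hUe, hconv⟩ :=
    exists_mem_nhds_convex_image_extend (I := 𝓡∂ n) e.1 (mem_chart_source _ p)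
  have hcrit (x : M) (hx : x ∈ U) :
      mfderiv (𝓡∂ n) 𝓘(ℝ, ℝ) f x = 0 ↔ partials e.1 f x = 0 := by
    rw [mfderiv_eq_zero_iff e (hf.mdifferentiable (by simp) x) (hUe hx), funext_iff]
    rfl
  have hprop {x y : M} (hx : x ∈ U) (hy : y ∈ U) (h : mfderiv (𝓡∂ n) 𝓘(ℝ, ℝ) f x = 0) :
      mfderiv (𝓡∂ n) 𝓘(ℝ, ℝ) f y = 0 :=
    (hcrit y hy).2 <| eqOn_partials_zero e g hUe hconv hf.contMDiffOn
      (fun z hz => hess0 e z (hUe hz)) hx ((hcrit x hx).1 h) hy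
  filter_upwards [hU] with x hx
  exact propext ⟨hprop hx (mem_of_mem_nhds hU), hprop (mem_of_mem_nhds hU) hx⟩

theorem eq_of_hess_eq_zero_of_isLocalMax [PreconnectedSpace M]
    (hf : ContMDiff (𝓡∂ n) 𝓘(ℝ, ℝ) ∞ f)
    (hess0 : ∀ e : Chart n M, ∀ x ∈ e.1.source, ∀ i j, hess g e.1 f i j x = 0) (hx : IsLocalMax f x)
    (hν : x ∈ (𝓡∂ n).boundary M → normalDeriv g (chartAt (EuclideanHalfSpace n) x) f x = 0)
    (y : M) : f y = f x := by
  have hfd : MDifferentiable (𝓡∂ n) 𝓘(ℝ, ℝ) f := hf.mdifferentiable (by simp)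
  have : IsManifold (𝓡∂ n) 1 M := .of_le (n := ∞) (by simp)
  refine (isLocallyConstant_of_mfderiv_eq_zero hfd fun z => ?_).apply_eq_of_preconnectedSpace y x
  rw [(isLocallyConstant_mfderiv_eq_zero hf hess0).apply_eq_of_preconnectedSpace z x]
  exact mfderiv_eq_zero_of_isLocalMax g (hfd x) hx hν

end Hessian

section Adjoint

variable {n : ℕ} [NeZero n] {M : Type*} [TopologicalSpace M]
  [ChartedSpace (EuclideanHalfSpace n) M] [IsManifold (𝓡∂ n) ∞ M] (g : Metric n M)

theorem hess_const (e : OpenPartialHomeomorph M (EuclideanHalfSpace n)) (c : ℝ) (i j : Fin n)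
    (x : M) : hess g e (fun _ => c) i j x = 0 := by
  have h : pd e j (fun _ => c) = fun _ => 0 := funext fun x => pd_const e j c x
  simp only [hess, h, pd_const, mul_zero, Finset.sum_const_zero, sub_zero]

theorem adjointInt_const (c : ℝ) (e : Chart n M) (x : e.1.source) (i j : Fin n) :
    adjointInt g (fun _ => c) e x i j = -(c * ricci g e.1 i j x) := by
  simp [adjointInt, laplacian, hess_const]

theorem adjointBdry_const (c : ℝ) (e : Chart n M) (x : ↥(e.1.source ∩ (𝓡∂ n).boundary M))
    (i j : {i : Fin n // i ≠ 0}) :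
    adjointBdry g (fun _ => c) e x i j = -(c * secondFF g e.1 i j x) := by
  simp [adjointBdry, normalDeriv, pd_const]

theorem constants_subset_kerAdjoint_iff :
    {f : C^∞⟮𝓡∂ n, M; 𝓘(ℝ, ℝ), ℝ⟯ | ∃ c : ℝ, ∀ x, f x = c} ⊆ kerAdjoint g ↔
      IsRicciFlat g ∧ HasTotallyGeodesicBoundary g := by
  refine ⟨fun h => ?_, ?_⟩
  · have h1 : adjointOp g ⟨fun _ => 1, contMDiff_const⟩ = 0 := h ⟨1, fun _ => rfl⟩
    refine ⟨fun e x hx i j => ?_, fun e x hx i j hi hj => ?_⟩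
    · have hA : adjointInt g (fun _ => 1) = 0 := congrArg Prod.fst h1
      simpa [hA] using adjointInt_const g 1 e ⟨x, hx⟩ i j
    · have hB : adjointBdry g (fun _ => 1) = 0 := congrArg Prod.snd h1
      simpa [hB] using adjointBdry_const g 1 e ⟨x, hx⟩ ⟨i, hi⟩ ⟨j, hj⟩
  · rintro ⟨hRic, hII⟩ f ⟨c, hc⟩
    have hfc : (f : M → ℝ) = fun _ => c := funext hc
    refine Prod.ext ?_ ?_ <;> funext e x i j
    · change adjointInt g f e x i j = 0
      rw [hfc, adjointInt_const, hRic e x x.2, mul_zero, neg_zero]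
    · change adjointBdry g f e x i j = 0
      rw [hfc, adjointBdry_const, hII e x x.2 i j i.2 j.2, mul_zero, neg_zero]

variable {g} {e : Chart n M} {x : M} {f : M → ℝ}

theorem sum_gramInv_mul_gram (hx : x ∈ e.1.source) :
    ∑ i, ∑ j, gramInv g e.1 x i j * gram g e.1 x i j = n := by
  have hG := posDef_gram e g hx
  have hsymm : (gram g e.1 x).transpose = gram g e.1 x := hG.isHermitian
  calc ∑ i, ∑ j, gramInv g e.1 x i j * gram g e.1 x i j
      = (gramInv g e.1 x * (gram g e.1 x).transpose).trace := Matrix.sum_hadamard_eq _ _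
    _ = n := by
      rw [hsymm, gramInv, Matrix.nonsing_inv_mul _ hG.det_pos.ne'.isUnit, Matrix.trace_one,
        Fintype.card_fin]

theorem hess_eq_zero_of_eq_laplacian_mul_gram (hn : n ≠ 1) (hx : x ∈ e.1.source)
    (h : ∀ i j, hess g e.1 f i j x = laplacian g e.1 f x * gram g e.1 x i j) (i j : Fin n) :
    hess g e.1 f i j x = 0 := by
  have htrace : laplacian g e.1 f x = laplacian g e.1 f x * n := by
    calc laplacian g e.1 f x
        = ∑ i, ∑ j, gramInv g e.1 x i j * (laplacian g e.1 f x * gram g e.1 x i j) := by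
          simp only [← h]
          rfl
      _ = laplacian g e.1 f x * n := by
          simp only [← sum_gramInv_mul_gram (g := g) hx, Finset.mul_sum, mul_left_comm]
  have hΔ : laplacian g e.1 f x = 0 := by
    by_contra hΔ
    exact hn (by exact_mod_cast (left_eq_mul₀ hΔ).1 htrace)
  rw [h, hΔ, zero_mul]

theorem hess_eq_zero_of_adjointInt_eq_zero (hn : n ≠ 1) (hRic : IsRicciFlat g)
    (hf : adjointInt g f = 0) (hx : x ∈ e.1.source) (i j : Fin n) : hess g e.1 f i j x = 0 := by
  refine hess_eq_zero_of_eq_laplacian_mul_gram hn hx (fun i j => ?_) i j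
  have h : adjointInt g f e ⟨x, hx⟩ i j = 0 := by rw [hf]; rfl
  rw [adjointInt, hRic e x hx, mul_zero, sub_zero] at h
  linarith

theorem normalDeriv_eq_zero_of_adjointBdry_eq_zero (hn : 2 ≤ n)
    (hII : HasTotallyGeodesicBoundary g) (hf : adjointBdry g f = 0)
    (hx : x ∈ e.1.source ∩ (𝓡∂ n).boundary M) : normalDeriv g e.1 f x = 0 := by
  have : Nontrivial (Fin n) := Fin.nontrivial_iff_two_le.2 hn
  obtain ⟨k, hk⟩ := exists_ne (0 : Fin n)
  have h : adjointBdry g f e ⟨x, hx⟩ ⟨k, hk⟩ ⟨k, hk⟩ = 0 := by rw [hf]; rfl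
  rw [adjointBdry, hII e x hx k k hk hk, mul_zero, sub_zero] at h
  exact (mul_eq_zero.1 h).resolve_right (posDef_gram e g hx.1).diag_pos.ne'

theorem exists_eq_const_of_mem_kerAdjoint [CompactSpace M] [ConnectedSpace M] (hn : 2 ≤ n)
    (hRic : IsRicciFlat g) (hII : HasTotallyGeodesicBoundary g)
    {f : C^∞⟮𝓡∂ n, M; 𝓘(ℝ, ℝ), ℝ⟯} (hf : f ∈ kerAdjoint g) : ∃ c : ℝ, ∀ x, f x = c := by
  have hA : adjointInt g f = 0 := congrArg Prod.fst hf
  have hB : adjointBdry g f = 0 := congrArg Prod.snd hf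
  obtain ⟨p, -, hp⟩ :=
    isCompact_univ.exists_isMaxOn univ_nonempty f.contMDiff.continuous.continuousOn
  refine ⟨f p, eq_of_hess_eq_zero_of_isLocalMax f.contMDiff
    (fun e x hx => hess_eq_zero_of_adjointInt_eq_zero (by lia) hRic hA hx)
    (hp.isLocalMax Filter.univ_mem) fun hpb => ?_⟩
  exact normalDeriv_eq_zero_of_adjointBdry_eq_zero
    (e := ⟨chartAt _ p, IsManifold.chart_mem_maximalAtlas p⟩) hn hII hB ⟨mem_chart_source _ p, hpb⟩

end Adjoint

end RiemBdry

theorem proposition3p3_general {n : ℕ} [NeZero n] (hn : 2 ≤ n) {M : Type*} [TopologicalSpace M]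
    [CompactSpace M] [ConnectedSpace M] [ChartedSpace (EuclideanHalfSpace n) M]
    [IsManifold (𝓡∂ n) ∞ M] (g : RiemBdry.Metric n M) :
    (RiemBdry.IsRicciFlat g ∧ RiemBdry.HasTotallyGeodesicBoundary g) ↔
      RiemBdry.kerAdjoint g = {f | ∃ c : ℝ, ∀ x, f x = c} := by
  refine ⟨fun h => ?_, fun h => (RiemBdry.constants_subset_kerAdjoint_iff g).1 h.ge⟩
  exact Subset.antisymm (fun f => RiemBdry.exists_eq_const_of_mem_kerAdjoint hn h.1 h.2)
    ((RiemBdry.constants_subset_kerAdjoint_iff g).2 h)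

theorem proposition3p3 {n : ℕ} [NeZero n] (hn : 2 ≤ n) {M : Type*} [TopologicalSpace M]
    [T2Space M] [CompactSpace M] [ConnectedSpace M]
    [ChartedSpace (EuclideanHalfSpace n) M] [IsManifold (𝓡∂ n) ∞ M]
    (g : RiemBdry.Metric n M) :
    (RiemBdry.IsRicciFlat g ∧ RiemBdry.HasTotallyGeodesicBoundary g) ↔
      RiemBdry.kerAdjoint g = {f | ∃ c : ℝ, ∀ x, f x = c} :=
  proposition3p3_general hn g
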